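/- Let $\Omega\subset\mathbb R^3$ be a bounded Lipschitz domain and let $B\subset\Omega$ be a Lipschitz domain. Let $j_c>0$, let $\boldsymbol E_d\in C^1(B;\mathbb R^3)$ and $\kappa\in C^1(B)$ with $\kappa>0$ in $B$, let $\boldsymbol f\in L^2(\Omega;\mathbb R^3)\cap C^1(B;\mathbb R^3)$, and let $\epsilon,\nu\in L^\infty(\Omega;\mathbb R^{3\times3})\cap C^1(B;\mathbb R^{3\times3})$ be symmetric and uniformly positive definite, i.e. there are $\underline\nu,\underline\epsilon>0$ with $\xi^{\mathsf T}\nu(x)\xi\ge\underline\nu|\xi|^2$ and $\xi^{\mathsf T}\epsilon(x)\xi\ge\underline\epsilon|\xi|^2$ for a.e. $x\in\Omega$ and all $\xi\in\mathbb R^3$. Here $C^1(B)$ is the space of continuously differentiable functions on $B$ that are bounded together with their first derivatives. Let $\boldsymbol H_0(\mathbf{curl})$ be the closure of $C_0^\infty(\Omega;\mathbb R^3)$ in $\boldsymbol H(\mathbf{curl})=\{\boldsymbol v\in L^2(\Omega;\mathbb R^3):\mathbf{curl}\,\boldsymbol v\in L^2(\Omega;\mathbb R^3)\}$ with its graph norm,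 and put $$a(\boldsymbol v,\boldsymbol w)=\int_\Omega\nu\,\mathbf{curl}\,\boldsymbol v\cdot\mathbf{curl}\,\boldsymbol w\,dx+\int_\Omega\epsilon\,\boldsymbol v\cdot\boldsymbol w\,dx .$$ Fix $L\ge0$ and $r>0$, and let $\mathcal O$ be the set of all open sets $\omega\subset B$ that are uniformly Lipschitz with constant $L$: for every $x_0\in\partial\omega$ there are Cartesian coordinates $(y_1,y_2,y_3)$ centred at $x_0$ and an $L$-Lipschitz function $\varphi:\mathbb R^2\to\mathbb R$ such that, in the open ball of radius $r$ about $x_0$, $\omega$ consists exactly of the points with $y_3>\varphi(y_1,y_2)$. Let $\gamma>0$ be fixed and let $$\max\nolimits_\gamma\{1,s\}=\begin{cases}s,& s-1\ge\frac1{2\gamma},\\ 1+\frac\gamma2\left(s-1+\frac1{2\gamma}\right)^2,&|s-1|\le\frac1{2\gamma},\\ 1,& s-1\le-\frac1{2\gamma}.\end{cases}$$ Then for every $\omega\in\mathcal O$ there is a unique $\boldsymbol E^\gamma(\omega)=\boldsymbol E^\gamma\in\boldsymbol H_0(\mathbf{curl})$ such that $$a(\boldsymbol E^\gamma,\boldsymbol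 v)+\int_\omega\frac{j_c\gamma\,\boldsymbol E^\gamma}{\max_\gamma\{1,\gamma|\boldsymbol E^\gamma|\}}\cdot\boldsymbol v\,dx=\int_\Omega\boldsymbol f\cdot\boldsymbol v\,dx\qquad\text{for all }\boldsymbol v\in\boldsymbol H_0(\mathbf{curl}),$$ and the penalized shape optimization problem $$\min_{\omega\in\mathcal O}J_\gamma(\omega),\qquad J_\gamma(\omega)=\frac12\int_B\kappa\,|\boldsymbol E^\gamma(\omega)-\boldsymbol E_d|^2\,dx+\int_\omega dx,$$ has an optimal shape: there is $\omega_\star^\gamma\in\mathcal O$ with $J_\gamma(\omega_\star^\gamma)\le J_\gamma(\omega)$ for all $\omega\in\mathcal O$. -/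

import Mathlib

open MeasureTheory Set
open scoped NNReal ENNReal Matrix

noncomputable section

/-- Three-dimensional Euclidean space. -/
abbrev E3 : Type := EuclideanSpace ℝ (Fin 3)

/-! ### Lipschitz sets -/

/-- Near the point `x₀`, the set `U` is the strict epigraph of an `L`-Lipschitz function of two
variables: in a Cartesian coordinate system `R` centred at `x₀`, the part of `U` in the open ball of
radius `r` about `x₀` consists of the points of that ball with `y₃ > φ (y₁, y₂)`. -/
def IsLipschitzEpigraphNear (U : Set E3) (L : ℝ≥0) (r : ℝ) (x₀ : E3) : Prop :=
  ∃ (R : E3 ≃ₗᵢ[ℝ] E3) (φ : EuclideanSpace ℝ (Fin 2) → ℝ), LipschitzWith L φ ∧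
    ∀ x ∈ Metric.ball x₀ r,
      (x ∈ U ↔ φ !₂[R (x - x₀) 0, R (x - x₀) 1] < R (x - x₀) 2)

/-- A Lipschitz domain: a nonempty connected open set whose boundary is locally a Lipschitz graph,
with the set on one side of it. -/
def IsLipschitzDomain (U : Set E3) : Prop :=
  IsOpen U ∧ IsConnected U ∧
    ∀ x₀ ∈ frontier U, ∃ (L : ℝ≥0) (r : ℝ), 0 < r ∧ IsLipschitzEpigraphNear U L r x₀

/-- A uniformly Lipschitz set: one Lipschitz constant `L` and one size `r` of the neighbourhoods
serve all boundary points. -/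
def IsUniformlyLipschitz (L : ℝ≥0) (r : ℝ) (U : Set E3) : Prop :=
  ∀ x₀ ∈ frontier U, IsLipschitzEpigraphNear U L r x₀

/-! ### Functions of class `C¹` with finite `C¹` norm -/

/-- `u ∈ C¹(B)` for an open set `B`: `u` is continuously differentiable in `B`, and `u` and its
derivative are bounded in `B`. -/
def IsC1 {F : Type*} [NormedAddCommGroup F] [NormedSpace ℝ F] (B : Set E3) (u : E3 → F) : Prop :=
  ContDiffOn ℝ 1 u B ∧ ∃ C : ℝ, ∀ x ∈ B, ‖u x‖ ≤ C ∧ ‖fderiv ℝ u x‖ ≤ C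

/-! ### The spaces `H(curl)` and `H₀(curl)` -/

/-- The partial derivative `∂ᵢ φⱼ`. -/
def partialD (φ : E3 → E3) (i j : Fin 3) (x : E3) : ℝ :=
  (fderiv ℝ φ x (EuclideanSpace.single i 1)) j

/-- The classical curl of a differentiable vector field. -/
def curl (φ : E3 → E3) (x : E3) : E3 :=
  !₂[partialD φ 1 2 x - partialD φ 2 1 x,
     partialD φ 2 0 x - partialD φ 0 2 x,
     partialD φ 0 1 x - partialD φ 1 0 x]

/-- The test fields: smooth vector fields with compact support in `Ω`. -/
def IsTestField (Ω : Set E3) (φ : E3 → E3) : Prop :=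
  ContDiff ℝ (⊤ : ℕ∞) φ ∧ HasCompactSupport φ ∧ tsupport φ ⊆ Ω

/-- The Hilbert space of square integrable vector fields on `Ω`. -/
abbrev L2Field (Ω : Set E3) : Type := Lp E3 2 (volume.restrict Ω)

/-- Pairs of square integrable vector fields with the norm `(‖v‖² + ‖c‖²) ^ (1/2)`. -/
abbrev L2Pair (Ω : Set E3) : Type := WithLp 2 (L2Field Ω × L2Field Ω)

/-- `c` is the curl of `v` in the sense of distributions on `Ω`. -/
def IsWeakCurl (Ω : Set E3) (v c : L2Field Ω) : Prop :=
  ∀ φ : E3 → E3, IsTestField Ω φ →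
    ∫ x in Ω, inner ℝ (c x) (φ x) = ∫ x in Ω, inner ℝ (v x) (curl φ x)

theorem continuous_partialD {φ : E3 → E3} (h : ContDiff ℝ (⊤ : ℕ∞) φ) (i j : Fin 3) :
    Continuous (partialD φ i j) := by
  have h1 : Continuous (fderiv ℝ φ) := h.continuous_fderiv (by simp)
  have h2 : Continuous fun x => fderiv ℝ φ x (EuclideanSpace.single i (1 : ℝ)) :=
    h1.clm_apply continuous_const
  exact (EuclideanSpace.proj (𝕜 := ℝ) j).continuous.comp h2

theorem IsTestField.memLp {Ω : Set E3} {φ : E3 → E3} (h : IsTestField Ω φ) :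
    MemLp φ 2 (volume.restrict Ω) :=
  h.1.continuous.memLp_of_hasCompactSupport h.2.1

theorem IsTestField.memLp_curl {Ω : Set E3} {φ : E3 → E3} (h : IsTestField Ω φ) :
    MemLp (curl φ) 2 (volume.restrict Ω) := by
  have hc : Continuous (curl φ) := by
    refine (PiLp.continuous_toLp 2 _).comp (continuous_pi fun k => ?_)
    fin_cases k <;>
      exact (continuous_partialD h.1 _ _).sub (continuous_partialD h.1 _ _)
  refine hc.memLp_of_hasCompactSupport ?_
  refine (h.2.1.fderiv (𝕜 := ℝ)).mono' fun x hx => ?_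
  by_contra hx'
  have h0 : fderiv ℝ φ x = 0 := by
    by_contra h1
    exact hx' (subset_tsupport _ h1)
  apply hx
  ext k
  fin_cases k <;> simp [curl, partialD, h0]

theorem integral_inner_add_L2 {Ω : Set E3} (u v : L2Field Ω) {g : E3 → E3}
    (hg : MemLp g 2 (volume.restrict Ω)) :
    ∫ x in Ω, inner ℝ ((u + v : L2Field Ω) x) (g x)
      = (∫ x in Ω, inner ℝ (u x) (g x)) + ∫ x in Ω, inner ℝ (v x) (g x) := by
  have key : ∀ w : L2Field Ω, Integrable (fun x => inner ℝ (w x) (g x)) (volume.restrict Ω) := by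
    intro w
    refine (L2.integrable_inner (𝕜 := ℝ) w (hg.toLp g)).congr ?_
    filter_upwards [hg.coeFn_toLp] with x hx
    rw [hx]
  rw [← integral_add (key u) (key v)]
  refine integral_congr_ae ?_
  filter_upwards [Lp.coeFn_add u v] with x hx
  rw [hx, Pi.add_apply, inner_add_left]

theorem integral_inner_smul_L2 {Ω : Set E3} (t : ℝ) (v : L2Field Ω) (g : E3 → E3) :
    ∫ x in Ω, inner ℝ ((t • v : L2Field Ω) x) (g x) = t * ∫ x in Ω, inner ℝ (v x) (g x) := by
  rw [← integral_const_mul]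
  refine integral_congr_ae ?_
  filter_upwards [Lp.coeFn_smul t v] with x hx
  rw [hx, Pi.smul_apply, real_inner_smul_left]

/-- The space `H(curl)`, each field `v` being stored together with its distributional curl as the
pair `(v, curl v)`, so that the norm of the pair is the norm of `H(curl)`. -/
def Hcurl (Ω : Set E3) : Submodule ℝ (L2Pair Ω) where
  carrier := {p | IsWeakCurl Ω p.fst p.snd}
  add_mem' := by
    intro p q hp hq φ hφ
    rw [WithLp.add_fst, WithLp.add_snd, integral_inner_add_L2 _ _ hφ.memLp,
      integral_inner_add_L2 _ _ hφ.memLp_curl, hp φ hφ, hq φ hφ]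
  zero_mem' := by
    intro φ hφ
    have h := integral_inner_smul_L2 (Ω := Ω) 0 0
    simp only [zero_smul, zero_mul] at h
    rw [WithLp.zero_fst, WithLp.zero_snd, h, h]
  smul_mem' := by
    intro t p hp φ hφ
    rw [WithLp.smul_fst, WithLp.smul_snd, integral_inner_smul_L2, integral_inner_smul_L2, hp φ hφ]

/-- The pairs `(φ, curl φ)` of the test fields `φ`. -/
def testPairs (Ω : Set E3) : Set (L2Pair Ω) :=
  {p | ∃ φ : E3 → E3, IsTestField Ω φ ∧
    p.fst =ᵐ[volume.restrict Ω] φ ∧ p.snd =ᵐ[volume.restrict Ω] curl φ}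

/-- The space `H₀(curl)`: the closure of the test fields with respect to the norm of `H(curl)`.
(The pairs `testPairs Ω` already form a linear space.) -/
def H0curl (Ω : Set E3) : Submodule ℝ (L2Pair Ω) :=
  Hcurl Ω ⊓ (Submodule.span ℝ (testPairs Ω)).topologicalClosure

/-- The vector field underlying an element of `H₀(curl)`. -/
def field {Ω : Set E3} (v : H0curl Ω) : E3 → E3 := v.1.fst

/-- The curl of an element of `H₀(curl)`. -/
def rot {Ω : Set E3} (v : H0curl Ω) : E3 → E3 := v.1.snd

/-! ### The penalized dual variable -/

/-- The regularized maximum `max_γ {1, s}`. -/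
def maxReg (γ s : ℝ) : ℝ :=
  if 1 / (2 * γ) ≤ s - 1 then s
  else if |s - 1| ≤ 1 / (2 * γ) then 1 + γ / 2 * (s - 1 + 1 / (2 * γ)) ^ 2
  else 1

/-- The vector `j γ e / max_γ {1, γ |e|}`. -/
def dualMap (j γ : ℝ) (e : E3) : E3 :=
  (j * γ / maxReg γ (γ * ‖e‖)) • e

/-! ### The shape optimization problem -/

/-- The data of the problem: the domain `Ω`, the region `B` for the superconductor, the critical
current density `jc`, the weight `κ`, the target field `Ed`, the magnetic reluctivity `ν`, the
electric permittivity `ε`, and the applied current source `f`. -/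
structure HTSData where
  Ω : Set E3
  B : Set E3
  jc : ℝ
  κ : E3 → ℝ
  Ed : E3 → E3
  ν : E3 → Matrix (Fin 3) (Fin 3) ℝ
  ε : E3 → Matrix (Fin 3) (Fin 3) ℝ
  f : E3 → E3

/-- A material parameter: a matrix function in `L^∞(Ω) ∩ C¹(B)` that is symmetric and uniformly
positive definite a.e. in `Ω`. -/
structure IsMaterialParameter (Ω B : Set E3) (A : E3 → Matrix (Fin 3) (Fin 3) ℝ) : Prop where
  memLp_top : ∀ i j, MemLp (fun x => A x i j) ∞ (volume.restrict Ω)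
  isC1 : ∀ i j, IsC1 B fun x => A x i j
  symm : ∀ᵐ x ∂volume.restrict Ω, (A x).IsSymm
  posDef : ∃ a : ℝ, 0 < a ∧
    ∀ᵐ x ∂volume.restrict Ω, ∀ ξ : E3, a * ‖ξ‖ ^ 2 ≤ ξ.ofLp ⬝ᵥ (A x *ᵥ ξ.ofLp)

namespace HTSData

/-- The standing assumptions on the data. -/
structure Admissible (D : HTSData) : Prop where
  bounded : Bornology.IsBounded D.Ω
  lipschitz : IsLipschitzDomain D.Ω
  subset : D.B ⊆ D.Ω
  lipschitz_B : IsLipschitzDomain D.B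
  isC1_Ed : IsC1 D.B D.Ed
  isC1_κ : IsC1 D.B D.κ
  κ_pos : ∀ x ∈ D.B, 0 < D.κ x
  jc_pos : 0 < D.jc
  material_ν : IsMaterialParameter D.Ω D.B D.ν
  material_ε : IsMaterialParameter D.Ω D.B D.ε
  memLp_f : MemLp D.f 2 (volume.restrict D.Ω)
  isC1_f : IsC1 D.B D.f

/-- The admissible shapes: the open subsets of `B` that are Lipschitz, uniformly with constant `L`
(in neighbourhoods of size `r`). -/
def shapes (D : HTSData) (L : ℝ≥0) (r : ℝ) : Set (Set E3) :=
  {ω | ω ⊆ D.B ∧ IsOpen ω ∧ IsUniformlyLipschitz L r ω}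

/-- The bilinear form `a(v, w) = ∫_Ω ν curl v · curl w + ∫_Ω ε v · w`. -/
def bilin (D : HTSData) (v w : H0curl D.Ω) : ℝ :=
  (∫ x in D.Ω, (D.ν x *ᵥ (rot v x).ofLp) ⬝ᵥ (rot w x).ofLp)
    + ∫ x in D.Ω, (D.ε x *ᵥ (field v x).ofLp) ⬝ᵥ (field w x).ofLp

/-- `E` solves the penalized state equation for the shape `ω`:
`a(E, v) + ∫_ω λ · v = ∫_Ω f · v` for all `v` in `H₀(curl)`, where
`λ = jc γ E / max_γ {1, γ |E|}` in `ω`. -/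
def IsState (D : HTSData) (γ : ℝ) (ω : Set E3) (E : H0curl D.Ω) : Prop :=
  ∀ v : H0curl D.Ω,
    D.bilin E v + ∫ x in ω, inner ℝ (dualMap D.jc γ (field E x)) (field v x)
      = ∫ x in D.Ω, inner ℝ (D.f x) (field v x)

/-- The electric field `E^γ(ω)`: the solution of the penalized state equation. -/
def state (D : HTSData) (γ : ℝ) (ω : Set E3) : H0curl D.Ω :=
  Classical.epsilon (D.IsState γ ω)

/-- The cost `J_γ(ω) = ½ ∫_B κ |E^γ(ω) - Ed|² + ∫_ω 1`. -/
def cost (D : HTSData) (γ : ℝ) (ω : Set E3) : ℝ :=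
  1 / 2 * (∫ x in D.B, D.κ x * ‖field (D.state γ ω) x - D.Ed x‖ ^ 2) + ∫ _x in ω, (1 : ℝ)

end HTSData

end

/-!
The normalized charts of uniformly Lipschitz sets are equi-Lipschitz graph functions and isometries,
so along an ultrafilter they converge; their limits are charts of the largest open limit of the
sets. Off these limit graphs, which are null sets, the indicator functions converge, and hence
the admissible shapes form a compact set for the pseudometric `volume (ω ∆ ω')`.

The regularized maximum is a maximum of functions that are affine in `s` with slopes in `[0, 1]`,
which makes `x ↦ jc γ x / max_γ {1, γ |x|}` monotone and Lipschitz. The state equation is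
therefore governed by a strongly monotone Lipschitz operator on `H₀(curl)`, with a monotonicity
constant that does not depend on the shape: it is uniquely solvable and its solution depends
continuously on the shape. The cost is thus a continuous function on a compact set.
-/

noncomputable section

open Filter Topology Metric
open scoped symmDiff Pointwise

/-! ### Limits of uniformly Lipschitz sets -/

section limits

variable {ι X : Type*}

theorem exists_tendsto_of_eventually_dist_le [PseudoMetricSpace X] [ProperSpace X]
    (𝒰 : Ultrafilter ι) {f : ι → X} {x : X} {C : ℝ} (h : ∀ᶠ n in 𝒰, dist (f n) x ≤ C) :
    ∃ y, Tendsto f 𝒰 (𝓝 y) :=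
  let ⟨y, _, hy⟩ := (isCompact_closedBall x C).ultrafilter_le_nhds' (𝒰.map f) h
  ⟨y, hy⟩

theorem exists_tendsto_linearIsometryEquiv {E : Type*} [NormedAddCommGroup E] [NormedSpace ℝ E]
    [FiniteDimensional ℝ E] (𝒰 : Ultrafilter ι) (R : ι → E ≃ₗᵢ[ℝ] E) :
    ∃ S : E ≃ₗᵢ[ℝ] E, ∀ x, Tendsto (fun n => R n x) 𝒰 (𝓝 (S x)) := by
  have : ProperSpace E := FiniteDimensional.proper ℝ E
  have h (x : E) : ∃ y, Tendsto (fun n => R n x) 𝒰 (𝓝 y) :=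
    exists_tendsto_of_eventually_dist_le 𝒰 (x := 0) (C := ‖x‖) (.of_forall fun n => by simp)
  choose S hS using h
  let T : E →ₗᵢ[ℝ] E :=
    { toFun := S
      map_add' := fun x y => tendsto_nhds_unique (hS (x + y)) (by simpa using (hS x).add (hS y))
      map_smul' := fun c x => tendsto_nhds_unique (hS (c • x)) (by simpa using (hS x).const_smul c)
      norm_map' := fun x => tendsto_nhds_unique (hS x).norm (by simp) }
  exact ⟨T.toLinearIsometryEquiv rfl, hS⟩

variable [PseudoMetricSpace X]

theorem exists_tendsto_lipschitzWith {Y : Type*} [MetricSpace Y] [ProperSpace Y]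
    (𝒰 : Ultrafilter ι) {K : ℝ≥0} {φ : ι → X → Y} {x₀ : X} {y₀ : Y}
    (hφ : ∀ᶠ n in 𝒰, LipschitzWith K (φ n)) (h₀ : ∀ᶠ n in 𝒰, φ n x₀ = y₀) :
    ∃ ψ : X → Y, LipschitzWith K ψ ∧ ∀ x, Tendsto (fun n => φ n x) 𝒰 (𝓝 (ψ x)) := by
  have h (x : X) : ∃ y, Tendsto (fun n => φ n x) 𝒰 (𝓝 y) := by
    refine exists_tendsto_of_eventually_dist_le 𝒰 (x := y₀) (C := K * dist x x₀) ?_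
    filter_upwards [hφ, h₀] with n hn hn₀
    simpa only [hn₀] using hn.dist_le_mul x x₀
  choose ψ hψ using h
  refine ⟨ψ, LipschitzWith.of_dist_le_mul fun x x' => ?_, hψ⟩
  exact le_of_tendsto ((hψ x).dist (hψ x')) (hφ.mono fun n hn => hn.dist_le_mul x x')

theorem tendsto_apply_of_lipschitzWith {Y : Type*} [PseudoMetricSpace Y] {l : Filter ι} {K : ℝ≥0}
    {f : ι → X → Y} {u : ι → X} {x : X} {y : Y} (hf : ∀ᶠ n in l, LipschitzWith K (f n))
    (hu : Tendsto u l (𝓝 x)) (hy : Tendsto (fun n => f n x) l (𝓝 y)) :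
    Tendsto (fun n => f n (u n)) l (𝓝 y) := by
  have hdist : Tendsto (fun n => K * dist x (u n)) l (𝓝 0) := by
    simpa using ((tendsto_const_nhds (x := x)).dist hu).const_mul (K : ℝ)
  exact tendsto_of_tendsto_of_dist hy <| squeeze_zero' (.of_forall fun _ => dist_nonneg)
    (hf.mono fun n hn => hn.dist_le_mul x (u n)) hdist

end limits

/-- The points having a neighbourhood that is contained in `ω n` for all `n` far along `l`: the
largest possible open limit of the sets `ω n`. -/
def innerLimit {ι X : Type*} [TopologicalSpace X] (l : Filter ι) (ω : ι → Set X) : Set X :=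
  {x | ∀ᶠ p in l ×ˢ 𝓝 x, p.2 ∈ ω p.1}

section innerLimit

variable {ι X : Type*}

section topology

variable [TopologicalSpace X] {l : Filter ι} {ω : ι → Set X} {x : X}

theorem mem_innerLimit_of_mem_nhds {s : Set X} (hs : s ∈ 𝓝 x) (h : ∀ᶠ n in l, s ⊆ ω n) :
    x ∈ innerLimit l ω :=
  (h.prod_mk hs).mono fun _ hp => hp.1 hp.2

theorem eventually_mem_of_mem_innerLimit (h : x ∈ innerLimit l ω) : ∀ᶠ n in l, x ∈ ω n :=
  h.curry.mono fun _ hn => hn.self_of_nhds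

theorem isOpen_innerLimit : IsOpen (innerLimit l ω) := by
  refine isOpen_iff_eventually.2 fun x hx => ?_
  obtain ⟨N, hN, t, ht, hsub⟩ := mem_prod_iff.1 hx
  filter_upwards [eventually_mem_nhds_iff.2 ht] with y hy
  exact mem_of_superset (prod_mem_prod hN hy) hsub

theorem innerLimit_subset [l.NeBot] {B : Set X} (h : ∀ᶠ n in l, ω n ⊆ B) : innerLimit l ω ⊆ B :=
  fun _ hx =>
    let ⟨_, hxn, hn⟩ := ((eventually_mem_of_mem_innerLimit hx).and h).exists
    hn hxn

theorem disjoint_innerLimit_compl [l.NeBot] :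
    Disjoint (innerLimit l ω) (innerLimit l fun n => (ω n)ᶜ) :=
  Set.disjoint_left.2 fun _ hx hx' =>
    let ⟨_, hn, hn'⟩ :=
      ((eventually_mem_of_mem_innerLimit hx).and (eventually_mem_of_mem_innerLimit hx')).exists
    hn' hn

theorem eventually_subset_of_isCompact_of_subset_innerLimit {K : Set X} (hK : IsCompact K)
    (h : K ⊆ innerLimit l ω) : ∀ᶠ n in l, K ⊆ ω n := by
  have hprod : ∀ᶠ p in l ×ˢ 𝓝ˢ K, p.2 ∈ ω p.1 := hK.mem_prod_nhdsSet_of_forall h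
  exact hprod.curry.mono fun n hn => subset_of_mem_nhdsSet hn

theorem inter_frontier_nonempty_of_isPreconnected {s t : Set X} (hs : IsPreconnected s)
    (ht : (s ∩ t).Nonempty) (htc : (s ∩ tᶜ).Nonempty) : (s ∩ frontier t).Nonempty := by
  by_contra! hempty
  have hcover : s ⊆ interior t ∪ interior tᶜ := fun x hx => by
    by_contra hx'
    rw [mem_union, not_or, interior_compl, mem_compl_iff, not_not] at hx'
    exact (hempty.subset ⟨hx, hx'.2, hx'.1⟩ : x ∈ (∅ : Set X))
  have hleft : (s ∩ interior t).Nonempty := ht.imp fun x hx =>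
    ⟨hx.1, (hcover hx.1).resolve_right fun h => interior_subset h hx.2⟩
  have hright : (s ∩ interior tᶜ).Nonempty := htc.imp fun x hx =>
    ⟨hx.1, (hcover hx.1).resolve_left fun h => hx.2 (interior_subset h)⟩
  obtain ⟨x, -, hx, hx'⟩ := hs _ _ isOpen_interior isOpen_interior hcover hleft hright
  exact interior_subset hx' (interior_subset hx)

theorem eventually_nonempty_inter_frontier [LocallyConnectedSpace X] {𝒰 : Ultrafilter ι}
    (h : x ∉ innerLimit 𝒰 ω) (h' : x ∉ innerLimit 𝒰 fun n => (ω n)ᶜ) {s : Set X} (hs : s ∈ 𝓝 x) :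
    ∀ᶠ n in 𝒰, (s ∩ frontier (ω n)).Nonempty := by
  obtain ⟨V, hVs, hV, hxV, hVconn⟩ :=
    locallyConnectedSpace_iff_subsets_isOpen_isConnected.1 inferInstance x s hs
  have hnot : ∀ᶠ n in 𝒰, ¬ V ⊆ ω n :=
    Ultrafilter.eventually_not.2 fun hn => h (mem_innerLimit_of_mem_nhds (hV.mem_nhds hxV) hn)
  have hnot' : ∀ᶠ n in 𝒰, ¬ V ⊆ (ω n)ᶜ :=
    Ultrafilter.eventually_not.2 fun hn => h' (mem_innerLimit_of_mem_nhds (hV.mem_nhds hxV) hn)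
  filter_upwards [hnot, hnot'] with n hn hn'
  refine (inter_frontier_nonempty_of_isPreconnected hVconn.isPreconnected
    (Set.not_subset.1 hn' |>.imp fun y hy => ⟨hy.1, not_not.1 hy.2⟩)
    (Set.not_subset.1 hn)).mono ?_
  exact inter_subset_inter_left _ hVs

end topology

theorem exists_tendsto_mem_frontier [PseudoMetricSpace X] [ProperSpace X] [LocallyConnectedSpace X]
    {𝒰 : Ultrafilter ι} {ω : ι → Set X} {x : X} (h : x ∉ innerLimit 𝒰 ω)
    (h' : x ∉ innerLimit 𝒰 fun n => (ω n)ᶜ) :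
    ∃ y : ι → X, (∀ᶠ n in 𝒰, y n ∈ frontier (ω n)) ∧ Tendsto y 𝒰 (𝓝 x) := by
  have hnearest : ∀ᶠ n in 𝒰, ∃ y ∈ frontier (ω n), infDist x (frontier (ω n)) = dist x y :=
    (eventually_nonempty_inter_frontier h h' univ_mem).mono fun n hn =>
      isClosed_frontier.exists_infDist_eq_dist (hn.mono inter_subset_right) x
  obtain ⟨y, hy⟩ := hnearest.choice
  refine ⟨y, hy.mono fun n hn => hn.1, Metric.tendsto_nhds.2 fun δ hδ => ?_⟩
  filter_upwards [hy, eventually_nonempty_inter_frontier h h' (ball_mem_nhds x hδ)]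
    with n hn ⟨z, hzx, hz⟩
  rw [dist_comm, ← hn.2]
  exact (infDist_le_dist_of_mem hz).trans_lt (mem_ball'.1 hzx)

theorem tendsto_measure_symmDiff_innerLimit [TopologicalSpace X] [MeasurableSpace X]
    [OpensMeasurableSpace X] [T2Space X] {μ : Measure X} [μ.InnerRegularCompactLTTop]
    {l : Filter ι} [l.NeBot] {ω : ι → Set X} {B : Set X} (hB : MeasurableSet B) (hμB : μ B ≠ ∞)
    (hsub : ∀ᶠ n in l, ω n ⊆ B)
    (hnull : μ (innerLimit l ω ∪ innerLimit l fun n => (ω n)ᶜ)ᶜ = 0) :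
    Tendsto (fun n => μ (ω n ∆ innerLimit l ω)) l (𝓝 0) := by
  have happrox {V : Set X} (hV : IsOpen V) {ε : ℝ≥0∞} (hε : ε ≠ 0) :
      ∃ K ⊆ V ∩ B, IsCompact K ∧ μ ((V ∩ B) \ K) < ε :=
    (hV.measurableSet.inter hB).exists_isCompact_sdiff_lt
      (measure_ne_top_of_subset inter_subset_right hμB) hε
  refine ENNReal.tendsto_nhds_zero.2 fun ε hε => ?_
  obtain ⟨K, hKsub, hK, hKε⟩ := happrox (isOpen_innerLimit (l := l) (ω := ω))
    (ENNReal.half_pos hε.ne').ne'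
  obtain ⟨K', hKsub', hK', hKε'⟩ := happrox (isOpen_innerLimit (l := l) (ω := fun n => (ω n)ᶜ))
    (ENNReal.half_pos hε.ne').ne'
  filter_upwards [hsub,
    eventually_subset_of_isCompact_of_subset_innerLimit hK (hKsub.trans inter_subset_left),
    eventually_subset_of_isCompact_of_subset_innerLimit hK' (hKsub'.trans inter_subset_left)]
    with n hnB hn hn'
  have hcover : ω n ∆ innerLimit l ω ⊆
      ((innerLimit l ω ∩ B) \ K ∪ ((innerLimit l fun n => (ω n)ᶜ) ∩ B) \ K') ∪
        (innerLimit l ω ∪ innerLimit l fun n => (ω n)ᶜ)ᶜ := by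
    rintro x (⟨hxω, hx⟩ | ⟨hx, hxω⟩)
    · by_cases hx' : x ∈ innerLimit l fun n => (ω n)ᶜ
      · exact .inl (.inr ⟨⟨hx', hnB hxω⟩, fun hxK => hn' hxK hxω⟩)
      · exact .inr fun h => h.elim hx hx'
    · exact .inl (.inl ⟨⟨hx, innerLimit_subset hsub hx⟩, fun hxK => hxω (hn hxK)⟩)
  calc μ (ω n ∆ innerLimit l ω)
      ≤ ε / 2 + ε / 2 + 0 := (measure_mono hcover).trans <| (measure_union_le _ _).trans <|
        add_le_add ((measure_union_le _ _).trans (add_le_add hKε.le hKε'.le)) hnull.le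
    _ = ε := by rw [add_zero, ENNReal.add_halves]

end innerLimit

/-- The height of the point `z` above the graph of `φ`. -/
def graphHeight (φ : EuclideanSpace ℝ (Fin 2) → ℝ) (z : E3) : ℝ :=
  z 2 - φ !₂[z 0, z 1]

section graphs

variable {φ : EuclideanSpace ℝ (Fin 2) → ℝ} {L : ℝ≥0}

theorem lipschitzWith_graphHeight (hφ : LipschitzWith L φ) :
    LipschitzWith (1 + L) (graphHeight φ) := by
  have hvert : LipschitzWith 1 fun z : E3 => z 2 :=
    LipschitzWith.of_dist_le_mul fun x y => by
      simpa [dist_eq_norm] using PiLp.norm_apply_le (x - y) 2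
  have hhoriz : LipschitzWith 1 fun z : E3 => !₂[z 0, z 1] :=
    LipschitzWith.of_dist_le_mul fun x y => by
      rw [NNReal.coe_one, one_mul, EuclideanSpace.dist_eq, EuclideanSpace.dist_eq]
      exact Real.sqrt_le_sqrt (by simp [Fin.sum_univ_two, Fin.sum_univ_three])
  exact (mul_one L) ▸ hvert.sub (hφ.comp hhoriz)

theorem continuous_graphHeight_chart (hφ : LipschitzWith L φ) (R : E3 ≃ₗᵢ[ℝ] E3) (x₀ : E3) :
    Continuous fun x => graphHeight φ (R (x - x₀)) :=
  (lipschitzWith_graphHeight hφ).continuous.comp (R.continuous.comp (continuous_sub_right x₀))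

theorem graphHeight_chart_add_smul (R : E3 ≃ₗᵢ[ℝ] E3) (x₀ x : E3) (t : ℝ) :
    graphHeight φ (R (x + t • R.symm (EuclideanSpace.single 2 1) - x₀))
      = graphHeight φ (R (x - x₀)) + t := by
  rw [add_sub_right_comm, map_add, map_smul, R.apply_symm_apply]
  simp [graphHeight, add_sub_right_comm]

theorem tendsto_graphHeight {ι : Type*} {l : Filter ι} {φs : ι → EuclideanSpace ℝ (Fin 2) → ℝ}
    {Rs : ι → E3 ≃ₗᵢ[ℝ] E3} {R : E3 ≃ₗᵢ[ℝ] E3} {u : ι → E3} {z : E3}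
    (hφs : ∀ᶠ n in l, LipschitzWith L (φs n)) (hφ : ∀ w, Tendsto (fun n => φs n w) l (𝓝 (φ w)))
    (hR : ∀ x, Tendsto (fun n => Rs n x) l (𝓝 (R x))) (hu : Tendsto u l (𝓝 z)) :
    Tendsto (fun n => graphHeight (φs n) (Rs n (u n))) l (𝓝 (graphHeight φ (R z))) := by
  have hRu : Tendsto (fun n => Rs n (u n)) l (𝓝 (R z)) :=
    tendsto_apply_of_lipschitzWith (.of_forall fun n => (Rs n).lipschitz) hu (hR z)
  exact tendsto_apply_of_lipschitzWith (hφs.mono fun _ => lipschitzWith_graphHeight) hRu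
    (tendsto_const_nhds.sub (hφ _))

end graphs

theorem measure_eq_zero_of_translation_equivariant {E : Type*} [NormedAddCommGroup E]
    [NormedSpace ℝ E] [FiniteDimensional ℝ E] [MeasurableSpace E] [BorelSpace E] (μ : Measure E)
    [μ.IsAddHaarMeasure] {F : E → ℝ} (hF : Measurable F) (e : E)
    (hFe : ∀ x (t : ℝ), F (x + t • e) = F x + t) : μ {x | F x = 0} = 0 := by
  have htranslate (n : ℕ) {x : E} (hx : x ∈ {(2⁻¹ : ℝ) ^ n • e} + {x | F x = 0}) :
      F x = 2⁻¹ ^ n := by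
    rw [singleton_add] at hx
    obtain ⟨y, hy, rfl⟩ := hx
    dsimp only
    rw [add_comm, hFe, show F y = 0 from hy, zero_add]
  refine Measure.addHaar_eq_zero_of_disjoint_translates μ (fun n => (2⁻¹ : ℝ) ^ n • e) ?_ ?_
    (hF (measurableSet_singleton 0))
  · exact isBounded_range_of_tendsto _
      ((tendsto_pow_atTop_nhds_zero_of_lt_one (by norm_num) (by norm_num)).smul_const e)
  · refine fun m n hmn => Set.disjoint_left.2 fun x hxm hxn => hmn ?_
    exact pow_right_injective₀ (by norm_num) (by norm_num)
      ((htranslate m hxm).symm.trans (htranslate n hxn))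

theorem exists_epigraph_chart {U : Set E3} {L : ℝ≥0} {r : ℝ} {x₀ : E3} (hU : IsOpen U)
    (hr : 0 < r) (hx₀ : x₀ ∈ frontier U) (h : IsLipschitzEpigraphNear U L r x₀) :
    ∃ (R : E3 ≃ₗᵢ[ℝ] E3) (φ : EuclideanSpace ℝ (Fin 2) → ℝ), LipschitzWith L φ ∧ φ 0 = 0 ∧
      ∀ x ∈ ball x₀ r, (x ∈ U ↔ 0 < graphHeight φ (R (x - x₀))) := by
  obtain ⟨R, φ, hφ, hchart⟩ := h
  replace hchart : ∀ x ∈ ball x₀ r, (x ∈ U ↔ 0 < graphHeight φ (R (x - x₀))) :=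
    fun x hx => (hchart x hx).trans sub_pos.symm
  refine ⟨R, φ, hφ, ?_, hchart⟩
  rw [hU.frontier_eq] at hx₀
  have hF := continuous_graphHeight_chart hφ R x₀
  have hnonpos : ¬ 0 < graphHeight φ (R (x₀ - x₀)) := fun hpos =>
    hx₀.2 ((hchart x₀ (mem_ball_self hr)).2 hpos)
  have hnonneg : ¬ graphHeight φ (R (x₀ - x₀)) < 0 := fun hneg => by
    obtain ⟨y, ⟨hy, hyneg⟩, hyU⟩ := mem_closure_iff.1 hx₀.1
      (ball x₀ r ∩ {x | graphHeight φ (R (x - x₀)) < 0})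
      (isOpen_ball.inter (isOpen_lt hF continuous_const)) ⟨mem_ball_self hr, hneg⟩
    exact lt_asymm hyneg ((hchart y hy).1 hyU)
  have h0 : (!₂[0, 0] : EuclideanSpace ℝ (Fin 2)) = 0 := by ext i; fin_cases i <;> rfl
  simpa [graphHeight, h0] using le_antisymm (not_lt.1 hnonpos) (not_lt.1 hnonneg)

section compactness

variable {ι : Type*} {𝒰 : Ultrafilter ι} {ω : ι → Set E3} {L : ℝ≥0} {r : ℝ}

theorem exists_epigraph_chart_innerLimit (hr : 0 < r) (hopen : ∀ᶠ n in 𝒰, IsOpen (ω n))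
    (hlip : ∀ᶠ n in 𝒰, IsUniformlyLipschitz L r (ω n)) {x₀ : E3} (hx₀ : x₀ ∉ innerLimit 𝒰 ω)
    (hx₀' : x₀ ∉ innerLimit 𝒰 fun n => (ω n)ᶜ) :
    ∃ (R : E3 ≃ₗᵢ[ℝ] E3) (φ : EuclideanSpace ℝ (Fin 2) → ℝ), LipschitzWith L φ ∧
      ∀ x ∈ ball x₀ r,
        (0 < graphHeight φ (R (x - x₀)) → x ∈ innerLimit 𝒰 ω) ∧
        (graphHeight φ (R (x - x₀)) < 0 → x ∈ innerLimit 𝒰 fun n => (ω n)ᶜ) := by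
  obtain ⟨y, hy, hyx₀⟩ := exists_tendsto_mem_frontier hx₀ hx₀'
  have hcharts : ∀ᶠ n in 𝒰, ∃ c : (E3 ≃ₗᵢ[ℝ] E3) × (EuclideanSpace ℝ (Fin 2) → ℝ),
      LipschitzWith L c.2 ∧ c.2 0 = 0 ∧
      ∀ x ∈ ball (y n) r, (x ∈ ω n ↔ 0 < graphHeight c.2 (c.1 (x - y n))) := by
    filter_upwards [hopen, hlip, hy] with n hωn hLn hyn
    obtain ⟨R, φ, h⟩ := exists_epigraph_chart hωn hr hyn (hLn _ hyn)
    exact ⟨(R, φ), h⟩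
  obtain ⟨c, hc⟩ := hcharts.choice
  obtain ⟨R, hR⟩ := exists_tendsto_linearIsometryEquiv 𝒰 fun n => (c n).1
  obtain ⟨φ, hφ, hlim⟩ := exists_tendsto_lipschitzWith 𝒰 (hc.mono fun n hn => hn.1)
    (hc.mono fun n hn => hn.2.1)
  refine ⟨R, φ, hφ, fun x hx => ?_⟩
  have hsub : Tendsto (fun p : ι × E3 => p.2 - y p.1) (𝒰 ×ˢ 𝓝 x) (𝓝 (x - x₀)) :=
    tendsto_snd.sub (hyx₀.comp tendsto_fst)
  have hheight : Tendsto (fun p : ι × E3 => graphHeight (c p.1).2 ((c p.1).1 (p.2 - y p.1)))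
      (𝒰 ×ˢ 𝓝 x) (𝓝 (graphHeight φ (R (x - x₀)))) :=
    tendsto_graphHeight (tendsto_fst.eventually (hc.mono fun n hn => hn.1))
      (fun w => (hlim w).comp tendsto_fst) (fun z => (hR z).comp tendsto_fst) hsub
  have hchart : ∀ᶠ p in 𝒰 ×ˢ 𝓝 x,
      (p.2 ∈ ω p.1 ↔ 0 < graphHeight (c p.1).2 ((c p.1).1 (p.2 - y p.1))) := by
    filter_upwards [tendsto_fst.eventually hc,
      hsub.norm.eventually_lt_const (mem_ball_iff_norm.1 hx)] with p hp hpr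
    exact hp.2.2 _ (mem_ball_iff_norm.2 hpr)
  constructor <;> intro hsign
  · filter_upwards [hchart, hheight.eventually_const_lt hsign] with p hp hpos
    exact hp.2 hpos
  · filter_upwards [hchart, hheight.eventually_lt_const hsign] with p hp hneg hmem
    exact lt_asymm hneg (hp.1 hmem)

theorem isUniformlyLipschitz_innerLimit (hr : 0 < r) (hopen : ∀ᶠ n in 𝒰, IsOpen (ω n))
    (hlip : ∀ᶠ n in 𝒰, IsUniformlyLipschitz L r (ω n)) :
    IsUniformlyLipschitz L r (innerLimit 𝒰 ω) := by
  intro x₀ hx₀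
  rw [isOpen_innerLimit.frontier_eq] at hx₀
  have hdisj : Disjoint (innerLimit 𝒰 ω) (innerLimit 𝒰 fun n => (ω n)ᶜ) :=
    disjoint_innerLimit_compl
  obtain ⟨R, φ, hφ, h⟩ := exists_epigraph_chart_innerLimit hr hopen hlip hx₀.2
    (Set.disjoint_left.1 (hdisj.closure_left isOpen_innerLimit) hx₀.1)
  refine ⟨R, φ, hφ, fun x hx => Iff.trans ⟨fun hxω => ?_, (h x hx).1⟩ sub_pos⟩
  -- An open set on which the height is nonnegative contains no point of height zero, since such a
  -- point could be pushed below the graph.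
  set e : E3 := R.symm (EuclideanSpace.single 2 1)
  have hpush : Tendsto (fun t : ℝ => x + t • e) (𝓝 0) (𝓝 x) :=
    Continuous.tendsto' (by fun_prop) _ _ (by simp)
  have hnear : ∀ᶠ t : ℝ in 𝓝[<] 0, x + t • e ∈ innerLimit 𝒰 ω ∩ ball x₀ r :=
    (hpush.mono_left nhdsWithin_le_nhds).eventually
      ((isOpen_innerLimit.inter isOpen_ball).mem_nhds ⟨hxω, hx⟩)
  obtain ⟨t, ⟨htω, htr⟩, ht⟩ := (hnear.and self_mem_nhdsWithin).exists
  have hnonneg : 0 ≤ graphHeight φ (R (x + t • e - x₀)) :=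
    not_lt.1 fun hneg => Set.disjoint_left.1 hdisj htω ((h _ htr).2 hneg)
  rw [graphHeight_chart_add_smul] at hnonneg
  exact (neg_pos.2 ht).trans_le (neg_le_iff_add_nonneg.2 hnonneg)

theorem volume_compl_innerLimit_union (hr : 0 < r) (hopen : ∀ᶠ n in 𝒰, IsOpen (ω n))
    (hlip : ∀ᶠ n in 𝒰, IsUniformlyLipschitz L r (ω n)) :
    volume (innerLimit 𝒰 ω ∪ innerLimit 𝒰 fun n => (ω n)ᶜ)ᶜ = 0 := by
  refine measure_null_of_locally_null _ fun x₀ hx₀ => ?_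
  rw [mem_compl_iff, mem_union, not_or] at hx₀
  obtain ⟨R, φ, hφ, h⟩ := exists_epigraph_chart_innerLimit hr hopen hlip hx₀.1 hx₀.2
  have hgraph : volume {x | graphHeight φ (R (x - x₀)) = 0} = 0 :=
    measure_eq_zero_of_translation_equivariant volume
      (continuous_graphHeight_chart hφ R x₀).measurable _ (graphHeight_chart_add_smul R x₀)
  refine ⟨_, inter_mem_nhdsWithin _ (ball_mem_nhds x₀ hr), measure_mono_null ?_ hgraph⟩
  rintro x ⟨hx, hxr⟩
  rw [mem_compl_iff, mem_union, not_or] at hx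
  exact le_antisymm (not_lt.1 fun hpos => hx.1 ((h x hxr).1 hpos))
    (not_lt.1 fun hneg => hx.2 ((h x hxr).2 hneg))

theorem isCompact_uniformlyLipschitz {B : Set E3} (hB : MeasurableSet B) (hvol : volume B ≠ ∞)
    (hr : 0 < r) :
    IsCompact {ω : MeasuredSets (volume : Measure E3) |
      (ω : Set E3) ⊆ B ∧ IsOpen (ω : Set E3) ∧ IsUniformlyLipschitz L r (ω : Set E3)} := by
  refine isCompact_iff_ultrafilter_le_nhds'.2 fun 𝒰 h𝒰 => ?_
  let shape : MeasuredSets (volume : Measure E3) → Set E3 := (↑)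
  have hmem : ∀ᶠ s in 𝒰, shape s ⊆ B ∧ IsOpen (shape s) ∧ IsUniformlyLipschitz L r (shape s) := h𝒰
  simp only [eventually_and] at hmem
  obtain ⟨hsub, hopen, hlip⟩ := hmem
  let limit : MeasuredSets (volume : Measure E3) :=
    ⟨innerLimit 𝒰 shape, isOpen_innerLimit.measurableSet⟩
  have hlim : Tendsto (fun s => volume (shape s ∆ limit)) 𝒰 (𝓝 0) :=
    tendsto_measure_symmDiff_innerLimit hB hvol hsub (volume_compl_innerLimit_union hr hopen hlip)
  exact ⟨limit, ⟨innerLimit_subset hsub, isOpen_innerLimit,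
    isUniformlyLipschitz_innerLimit hr hopen hlip⟩,
    tendsto_id'.1 (tendsto_iff_edist_tendsto_0.2 hlim)⟩

end compactness

/-! ### The regularized maximum and the dual variable -/

/-- A Legendre transform: the bounds on `maxReg` below hold because the slopes `q` lie in
`[0, 1]`. -/
theorem isGreatest_maxReg {γ : ℝ} (hγ : 0 < γ) (s : ℝ) :
    IsGreatest ((fun q => 1 - q + q * s + 1 / (2 * γ) * (q * (1 - q))) '' Icc 0 1)
      (maxReg γ s) := by
  have hγd : 2 * γ * (1 / (2 * γ)) = 1 := by field_simp
  have hd : 0 < 1 / (2 * γ) := by positivity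
  simp only [maxReg]
  generalize 1 / (2 * γ) = d at *
  split_ifs with hhigh hmid
  · refine ⟨⟨1, by simp, by ring⟩, ?_⟩
    rintro _ ⟨q, ⟨_, h1⟩, rfl⟩
    nlinarith [mul_nonneg (sub_nonneg.2 h1) (sub_nonneg.2 hhigh), mul_self_nonneg (1 - q)]
  · obtain ⟨hlow, _⟩ := abs_le.1 hmid
    refine ⟨⟨γ * (s - 1 + d), ⟨by nlinarith, by nlinarith⟩, ?_⟩, ?_⟩
    · linear_combination -(γ / 2 * (s - 1 + d) ^ 2) * hγd
    · rintro _ ⟨q, -, rfl⟩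
      have hsq : 1 + γ / 2 * (s - 1 + d) ^ 2 - (1 - q + q * s + d * (q * (1 - q)))
          = γ / 2 * (s - 1 + d - 2 * d * q) ^ 2 := by
        linear_combination (q * (s - 1 + d) - d * q ^ 2) * hγd
      exact sub_nonneg.1 (hsq ▸ by positivity)
  · have hlow : s - 1 < -d := by
      by_contra! h
      exact hmid (abs_le.2 ⟨h, (not_le.1 hhigh).le⟩)
    refine ⟨⟨0, by simp, by ring⟩, ?_⟩
    rintro _ ⟨q, ⟨h0, _⟩, rfl⟩
    nlinarith [mul_nonneg h0 (by linarith : 0 ≤ -d - (s - 1)), mul_self_nonneg q]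

section maxReg

variable {γ : ℝ} (hγ : 0 < γ)

include hγ

theorem one_le_maxReg (s : ℝ) : 1 ≤ maxReg γ s :=
  (isGreatest_maxReg hγ s).2 ⟨0, by simp, by ring⟩

theorem le_maxReg (s : ℝ) : s ≤ maxReg γ s :=
  (isGreatest_maxReg hγ s).2 ⟨1, by simp, by ring⟩

theorem maxReg_pos (s : ℝ) : 0 < maxReg γ s :=
  one_pos.trans_le (one_le_maxReg hγ s)

theorem monotone_maxReg : Monotone (maxReg γ) := by
  intro s t hst
  obtain ⟨q, hq, hs⟩ := (isGreatest_maxReg hγ s).1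
  have ht := (isGreatest_maxReg hγ t).2 ⟨q, hq, rfl⟩
  nlinarith [mul_nonneg hq.1 (sub_nonneg.2 hst)]

theorem monotone_sub_maxReg : Monotone fun s => s - maxReg γ s := by
  intro s t hst
  obtain ⟨q, hq, ht⟩ := (isGreatest_maxReg hγ t).1
  have hs := (isGreatest_maxReg hγ s).2 ⟨q, hq, rfl⟩
  nlinarith [mul_nonneg (sub_nonneg.2 hq.2) (sub_nonneg.2 hst)]

theorem lipschitzWith_maxReg : LipschitzWith 1 (maxReg γ) := by
  refine LipschitzWith.of_le_add fun s t => ?_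
  rcases le_total s t with h | h
  · linarith [monotone_maxReg hγ h, dist_nonneg (x := s) (y := t)]
  · linarith [monotone_sub_maxReg hγ h, le_abs_self (s - t), Real.dist_eq s t]

theorem monotoneOn_div_maxReg : MonotoneOn (fun s => s / maxReg γ s) (Ici 0) := by
  intro s hs t _ hst
  rw [div_le_div_iff₀ (maxReg_pos hγ s) (maxReg_pos hγ t)]
  nlinarith [monotone_sub_maxReg hγ hst, le_maxReg hγ s, mem_Ici.1 hs]

end maxReg

section dualMap

variable {E : Type*} [NormedAddCommGroup E]

theorem norm_smul_sub_smul_le [NormedSpace ℝ E] (a b : ℝ) (x y : E) :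
    ‖a • x - b • y‖ ≤ |a| * ‖x - y‖ + |a - b| * ‖y‖ := by
  have h : a • x - b • y = a • (x - y) + (a - b) • y := by module
  simpa only [h, norm_smul, Real.norm_eq_abs] using norm_add_le (a • (x - y)) ((a - b) • y)

theorem mul_sub_mul_norm_sub_le_inner [InnerProductSpace ℝ E] {a b : ℝ} (ha : 0 ≤ a)
    (hb : 0 ≤ b) (x y : E) :
    (a * ‖x‖ - b * ‖y‖) * (‖x‖ - ‖y‖) ≤ inner ℝ (a • x - b • y) (x - y) := by
  have hexp : inner ℝ (a • x - b • y) (x - y)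
      = a * ‖x‖ ^ 2 + b * ‖y‖ ^ 2 - (a + b) * inner ℝ x y := by
    simp only [inner_sub_left, inner_sub_right, real_inner_smul_left, real_inner_self_eq_norm_sq,
      real_inner_comm x y]
    ring
  rw [hexp]
  linarith [mul_le_mul_of_nonneg_left (real_inner_le_norm x y) (add_nonneg ha hb)]

variable {j γ : ℝ}

theorem dualMap_zero : dualMap j γ 0 = 0 :=
  smul_zero _

theorem lipschitzWith_dualMap (hj : 0 ≤ j) (hγ : 0 < γ) :
    LipschitzWith (2 * j * γ).toNNReal (dualMap j γ) := by
  refine LipschitzWith.of_dist_le_mul fun x y => ?_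
  rw [Real.coe_toNNReal _ (by positivity), dist_eq_norm, dist_eq_norm]
  have hlip : |maxReg γ (γ * ‖y‖) - maxReg γ (γ * ‖x‖)| ≤ γ * ‖x - y‖ := by
    refine ((lipschitzWith_maxReg hγ).dist_le_mul _ _).trans ?_
    rw [NNReal.coe_one, one_mul, Real.dist_eq, ← mul_sub, abs_mul, abs_of_pos hγ, norm_sub_rev]
    exact mul_le_mul_of_nonneg_left (abs_norm_sub_norm_le y x) hγ.le
  have hm := one_le_maxReg hγ (γ * ‖x‖)
  have hn := one_le_maxReg hγ (γ * ‖y‖)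
  have hny := le_maxReg hγ (γ * ‖y‖)
  refine (norm_smul_sub_smul_le _ _ x y).trans ?_
  generalize maxReg γ (γ * ‖x‖) = m at *
  generalize maxReg γ (γ * ‖y‖) = n at *
  have : 0 < m := by linarith
  have : 0 < n := by linarith
  have hcoef : |j * γ / m| ≤ j * γ := by
    rw [abs_of_nonneg (by positivity)]
    exact div_le_self (by positivity) hm
  have hdiff : |j * γ / m - j * γ / n| * ‖y‖ ≤ j * γ * ‖x - y‖ :=
    calc |j * γ / m - j * γ / n| * ‖y‖ = j * |n - m| * (γ * ‖y‖ / (m * n)) := by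
          have h : j * γ / m - j * γ / n = j * γ * (n - m) / (m * n) := by field_simp
          rw [h, abs_div, abs_mul, abs_of_nonneg (by positivity : 0 ≤ j * γ),
            abs_of_pos (by positivity : 0 < m * n)]
          ring
      _ ≤ j * (γ * ‖x - y‖) * 1 := by
          gcongr
          rw [div_le_one (by positivity)]
          nlinarith
      _ = j * γ * ‖x - y‖ := by ring
  linarith [mul_le_mul_of_nonneg_right hcoef (norm_nonneg (x - y))]

theorem inner_dualMap_sub_nonneg (hj : 0 ≤ j) (hγ : 0 < γ) (x y : E3) :
    0 ≤ inner ℝ (dualMap j γ x - dualMap j γ y) (x - y) := by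
  have hcoef (z : E3) : 0 ≤ j * γ / maxReg γ (γ * ‖z‖) :=
    div_nonneg (by positivity) (maxReg_pos hγ _).le
  have hradial : MonotoneOn (fun ρ => j * γ / maxReg γ (γ * ρ) * ρ) (Ici 0) := by
    intro ρ hρ σ hσ hρσ
    have h := monotoneOn_div_maxReg hγ (mem_Ici.2 (mul_nonneg hγ.le hρ))
      (mem_Ici.2 (mul_nonneg hγ.le hσ)) (mul_le_mul_of_nonneg_left hρσ hγ.le)
    calc _ = j * (γ * ρ / maxReg γ (γ * ρ)) := by ring
      _ ≤ j * (γ * σ / maxReg γ (γ * σ)) := mul_le_mul_of_nonneg_left h hj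
      _ = _ := by ring
  refine le_trans ?_ (mul_sub_mul_norm_sub_le_inner (hcoef x) (hcoef y) x y)
  rcases le_total ‖x‖ ‖y‖ with h | h
  · exact mul_nonneg_of_nonpos_of_nonpos
      (sub_nonpos.2 (hradial (norm_nonneg x) (norm_nonneg y) h)) (sub_nonpos.2 h)
  · exact mul_nonneg (sub_nonneg.2 (hradial (norm_nonneg y) (norm_nonneg x) h)) (sub_nonneg.2 h)

end dualMap

/-! ### Strongly monotone operators -/

section stronglyMonotone

variable {H : Type*} [NormedAddCommGroup H] [InnerProductSpace ℝ H] {A : H → H} {c : ℝ}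

/-- Strong monotonicity, with constant `c`, of a nonlinear operator on an inner product space. -/
def IsStronglyMonotone (c : ℝ) (A : H → H) : Prop :=
  ∀ u v, c * ‖u - v‖ ^ 2 ≤ inner ℝ (A u - A v) (u - v)

namespace IsStronglyMonotone

theorem mul_norm_sub_le (hA : IsStronglyMonotone c A) (u v : H) :
    c * ‖u - v‖ ≤ ‖A u - A v‖ := by
  rcases (norm_nonneg (u - v)).eq_or_lt with h | h
  · simp only [← h, mul_zero, norm_nonneg]
  · refine le_of_mul_le_mul_right ?_ h
    linarith [hA u v, real_inner_le_norm (A u - A v) (u - v)]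

theorem norm_sub_sub_smul_sq_le (hA : IsStronglyMonotone c A) {K : ℝ≥0} (hK : LipschitzWith K A)
    {t : ℝ} (ht : 0 ≤ t) (u v : H) :
    ‖u - v - t • (A u - A v)‖ ^ 2 ≤ (1 - 2 * t * c + t ^ 2 * K ^ 2) * ‖u - v‖ ^ 2 := by
  have hlip : ‖A u - A v‖ ^ 2 ≤ K ^ 2 * ‖u - v‖ ^ 2 := by
    rw [← mul_pow]
    exact pow_le_pow_left₀ (norm_nonneg _) (hK.norm_sub_le u v) 2
  rw [norm_sub_sq_real, norm_smul, mul_pow, real_inner_smul_right, real_inner_comm,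
    Real.norm_eq_abs, sq_abs]
  linarith [mul_le_mul_of_nonneg_left (hA u v) ht, mul_le_mul_of_nonneg_left hlip (sq_nonneg t)]

theorem exists_contractingWith (hA : IsStronglyMonotone c A) (hc : 0 < c) {K : ℝ≥0}
    (hK : LipschitzWith K A) (F : H) :
    ∃ t > (0 : ℝ), ∃ q, ContractingWith q fun u => u - t • (A u - F) := by
  set M : ℝ := K ^ 2 + c ^ 2
  have hM : 0 < M := by positivity
  set t : ℝ := c / M
  have ht : 0 < t := by positivity
  have hq : (K : ℝ) ^ 2 / M < 1 := (div_lt_one hM).2 (lt_add_of_pos_right _ (by positivity))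
  have hfactor : 1 - 2 * t * c + t ^ 2 * K ^ 2 ≤ K ^ 2 / M := by
    have htM : t * M = c := div_mul_cancel₀ c hM.ne'
    have hKM : (K : ℝ) ^ 2 / M = 1 - t * c := by
      simp only [t, M]
      field_simp
      ring
    rw [hKM]
    nlinarith [mul_nonneg (sq_nonneg t) (sq_nonneg c)]
  refine ⟨t, ht, (√(K ^ 2 / M)).toNNReal, ?_, LipschitzWith.of_dist_le_mul fun u v => ?_⟩
  · exact Real.toNNReal_lt_one.2 ((Real.sqrt_lt' one_pos).2 (by rwa [one_pow]))
  · rw [dist_eq_norm, dist_eq_norm, Real.coe_toNNReal _ (Real.sqrt_nonneg _),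
      show u - t • (A u - F) - (v - t • (A v - F)) = u - v - t • (A u - A v) by module]
    refine abs_le_of_sq_le_sq' ?_ (by positivity) |>.2
    rw [mul_pow, Real.sq_sqrt (by positivity)]
    exact (hA.norm_sub_sub_smul_sq_le hK ht.le u v).trans (by gcongr)

/-- Zarantonello's theorem. -/
theorem existsUnique_eq [CompleteSpace H] (hA : IsStronglyMonotone c A) (hc : 0 < c) {K : ℝ≥0}
    (hK : LipschitzWith K A) (F : H) : ∃! u, A u = F := by
  obtain ⟨t, ht, q, hq⟩ := hA.exists_contractingWith hc hK F
  have hfixed (u : H) : A u = F ↔ Function.IsFixedPt (fun u => u - t • (A u - F)) u := by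
    rw [Function.IsFixedPt, sub_eq_self, smul_eq_zero_iff_right ht.ne', sub_eq_zero]
  simp only [hfixed]
  exact ⟨hq.fixedPoint, hq.fixedPoint_isFixedPt, fun v hv => hq.fixedPoint_unique hv⟩

theorem tendsto_solution {ι : Type*} {l : Filter ι} {A : ι → H → H} {u : ι → H} {u₀ F : H}
    (hA : ∀ i, IsStronglyMonotone c (A i)) (hc : 0 < c) (hu : ∀ i, A i (u i) = F)
    (hlim : Tendsto (fun i => A i u₀) l (𝓝 F)) : Tendsto u l (𝓝 u₀) := by
  rw [tendsto_iff_norm_sub_tendsto_zero] at hlim ⊢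
  have hlim' : Tendsto (fun i => c⁻¹ * ‖A i u₀ - F‖) l (𝓝 0) := by
    simpa only [mul_zero] using hlim.const_mul c⁻¹
  refine squeeze_zero (fun _ => norm_nonneg _) (fun i => ?_) hlim'
  rw [le_inv_mul_iff₀ hc, norm_sub_rev (A i u₀), ← hu i]
  exact (hA i).mul_norm_sub_le _ _

end IsStronglyMonotone

end stronglyMonotone

/-! ### Multiplication operators on `Lᵖ` spaces -/

section mulOp

variable {α E F : Type*} [MeasurableSpace α] {μ : Measure α} {p : ℝ≥0∞} [Fact (1 ≤ p)]
  [NormedAddCommGroup E] [NormedSpace ℝ E] [NormedAddCommGroup F] [NormedSpace ℝ F]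

/-- The operator `u ↦ (x ↦ A x (u x))` of pointwise application of an essentially bounded operator
field `A`. -/
def mulOp {A : α → E →L[ℝ] F} (hA : MemLp A ∞ μ) : Lp E p μ →L[ℝ] Lp F p μ :=
  (ContinuousLinearMap.id ℝ (E →L[ℝ] F)).holderL μ ∞ p p (hA.toLp A)

theorem coeFn_mulOp {A : α → E →L[ℝ] F} (hA : MemLp A ∞ μ) (u : Lp E p μ) :
    mulOp hA u =ᵐ[μ] fun x => A x (u x) := by
  filter_upwards [(ContinuousLinearMap.id ℝ (E →L[ℝ] F)).coeFn_holder (r := p) (hA.toLp A) u,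
    hA.coeFn_toLp] with x hx hAx
  rw [← hAx]
  exact hx

theorem memLp_top_indicator_id {s : Set α} (hs : MeasurableSet s) :
    MemLp (s.indicator fun _ => ContinuousLinearMap.id ℝ E) ∞ μ :=
  MemLp.indicator hs (memLp_top_const (ContinuousLinearMap.id ℝ E))

/-- Multiplication by the indicator function of the measurable set `s`. -/
def cutoff {s : Set α} (hs : MeasurableSet s) : Lp E p μ →L[ℝ] Lp E p μ :=
  mulOp (memLp_top_indicator_id hs)

theorem coeFn_cutoff {s : Set α} (hs : MeasurableSet s) (u : Lp E p μ) :
    cutoff hs u =ᵐ[μ] s.indicator u := by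
  filter_upwards [coeFn_mulOp (memLp_top_indicator_id hs) u] with x hx
  rw [cutoff, hx]
  by_cases h : x ∈ s <;> simp [h]

theorem edist_cutoff {s t : Set α} (hs : MeasurableSet s) (ht : MeasurableSet t) (u : Lp E p μ) :
    edist (cutoff hs u) (cutoff ht u) = eLpNorm ((s ∆ t).indicator u) p μ := by
  rw [Lp.edist_def, ← eLpNorm_indicator_sub_indicator]
  exact eLpNorm_congr_ae ((coeFn_cutoff hs u).sub (coeFn_cutoff ht u))

theorem tendsto_cutoff (hp : p ≠ ∞) {ι : Type*} {l : Filter ι} {s : ι → Set α} {t : Set α}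
    (hs : ∀ i, MeasurableSet (s i)) (ht : MeasurableSet t)
    (hlim : Tendsto (fun i => μ (s i ∆ t)) l (𝓝 0)) (u : Lp E p μ) :
    Tendsto (fun i => cutoff (hs i) u) l (𝓝 (cutoff ht u)) := by
  simp only [EMetric.tendsto_nhds, edist_cutoff]
  intro ε hε
  obtain ⟨ε', -, hlt⟩ := ENNReal.lt_iff_exists_real_btwn.1 hε
  obtain ⟨δ, hδ, h⟩ :=
    (Lp.memLp u).eLpNorm_indicator_le Fact.out hp (ENNReal.ofReal_pos.1 hlt.1)
  filter_upwards [ENNReal.tendsto_nhds_zero.1 hlim _ (ENNReal.ofReal_pos.2 hδ)] with i hi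
  exact (h _ ((hs i).symmDiff ht) hi).trans_lt hlt.2

end mulOp

section inner

variable {α E : Type*} [MeasurableSpace α] {μ : Measure α} [NormedAddCommGroup E]
  [InnerProductSpace ℝ E]

theorem integral_inner_eq_inner_toLp (u : Lp E 2 μ) {g : α → E} (hg : MemLp g 2 μ) :
    ∫ x, inner ℝ (u x) (g x) ∂μ = inner ℝ u (hg.toLp g) := by
  rw [L2.inner_def]
  refine integral_congr_ae ?_
  filter_upwards [hg.coeFn_toLp] with x hx
  rw [hx]

theorem inner_mulOp {A : α → E →L[ℝ] E} (hA : MemLp A ∞ μ) (u v : Lp E 2 μ) :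
    inner ℝ (mulOp hA u) v = ∫ x, inner ℝ (A x (u x)) (v x) ∂μ := by
  rw [L2.inner_def]
  refine integral_congr_ae ?_
  filter_upwards [coeFn_mulOp hA u] with x hx
  rw [hx]

theorem mul_norm_sq_le_inner_mulOp {A : α → E →L[ℝ] E} (hA : MemLp A ∞ μ) {a : ℝ}
    (ha : ∀ᵐ x ∂μ, ∀ ξ, a * ‖ξ‖ ^ 2 ≤ inner ℝ (A x ξ) ξ) (u : Lp E 2 μ) :
    a * ‖u‖ ^ 2 ≤ inner ℝ (mulOp hA u) u := by
  rw [← real_inner_self_eq_norm_sq, L2.inner_def, L2.inner_def, ← integral_const_mul]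
  refine integral_mono_ae ((L2.integrable_inner (𝕜 := ℝ) u u).const_mul a)
    (L2.integrable_inner (𝕜 := ℝ) _ _) ?_
  filter_upwards [ha, coeFn_mulOp hA u] with x hx hu
  rw [hu, real_inner_self_eq_norm_sq]
  exact hx _

theorem inner_cutoff {s : Set α} (hs : MeasurableSet s) (u v : Lp E 2 μ) :
    inner ℝ (cutoff hs u) v = ∫ x in s, inner ℝ (u x) (v x) ∂μ := by
  rw [L2.inner_def, ← integral_indicator hs]
  refine integral_congr_ae ?_
  filter_upwards [coeFn_cutoff hs u] with x hx
  by_cases h : x ∈ s <;> simp [hx, h]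

theorem inner_cutoff_compLp_sub_nonneg {g : E → E} {K : ℝ≥0} (hg : LipschitzWith K g)
    (hg0 : g 0 = 0) (hmono : ∀ x y, 0 ≤ inner ℝ (g x - g y) (x - y)) {s : Set α}
    (hs : MeasurableSet s) (u v : Lp E 2 μ) :
    0 ≤ inner ℝ (cutoff hs (hg.compLp hg0 u - hg.compLp hg0 v)) (u - v) := by
  rw [inner_cutoff]
  refine integral_nonneg_of_ae (ae_restrict_of_ae ?_)
  filter_upwards [Lp.coeFn_sub (hg.compLp hg0 u) (hg.compLp hg0 v), Lp.coeFn_sub u v,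
    hg.coeFn_compLp hg0 u, hg.coeFn_compLp hg0 v] with x hgsub hsub hgu hgv
  rw [hgsub, hsub, Pi.sub_apply, Pi.sub_apply, hgu, hgv]
  exact hmono _ _

theorem continuous_integral_mul_norm_sub_sq {w : α → ℝ} (hw : MemLp w ∞ μ) {d : α → E}
    (hd : MemLp d 2 μ) : Continuous fun u : Lp E 2 μ => ∫ x, w x * ‖u x - d x‖ ^ 2 ∂μ := by
  have hW : MemLp (fun x => w x • ContinuousLinearMap.id ℝ E) ∞ μ :=
    ((ContinuousLinearMap.id ℝ ℝ).smulRight (ContinuousLinearMap.id ℝ E)).comp_memLp' hw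
  have h (u : Lp E 2 μ) : ∫ x, w x * ‖u x - d x‖ ^ 2 ∂μ
      = inner ℝ (mulOp hW (u - hd.toLp d)) (u - hd.toLp d) := by
    rw [inner_mulOp]
    refine integral_congr_ae ?_
    filter_upwards [Lp.coeFn_sub u (hd.toLp d), hd.coeFn_toLp] with x hsub hdx
    rw [hsub, Pi.sub_apply, hdx, smul_apply, ContinuousLinearMap.id_apply,
      real_inner_smul_left, real_inner_self_eq_norm_sq]
  simp only [h]
  fun_prop

end inner

/-! ### Elliptic matrix fields -/

section elliptic

variable {α n : Type*} [MeasurableSpace α] {μ : Measure α} [Fintype n] [DecidableEq n]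

/-- A matrix field with essentially bounded entries that is uniformly positive definite almost
everywhere. -/
structure IsEllipticField (μ : Measure α) (A : α → Matrix n n ℝ) : Prop where
  memLp_top : ∀ i j, MemLp (fun x => A x i j) ∞ μ
  posDef : ∃ a : ℝ, 0 < a ∧
    ∀ᵐ x ∂μ, ∀ ξ : EuclideanSpace ℝ n, a * ‖ξ‖ ^ 2 ≤ ξ.ofLp ⬝ᵥ (A x *ᵥ ξ.ofLp)

theorem inner_toEuclideanCLM (A : Matrix n n ℝ) (x y : EuclideanSpace ℝ n) :
    inner ℝ (Matrix.toEuclideanCLM (n := n) (𝕜 := ℝ) A x) y = (A *ᵥ x.ofLp) ⬝ᵥ y.ofLp := by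
  rw [EuclideanSpace.inner_eq_star_dotProduct, Matrix.ofLp_toEuclideanCLM, star_trivial,
    dotProduct_comm]

theorem memLp_toEuclideanCLM {p : ℝ≥0∞} {A : α → Matrix n n ℝ}
    (hA : ∀ i j, MemLp (fun x => A x i j) p μ) :
    MemLp (fun x => Matrix.toEuclideanCLM (n := n) (𝕜 := ℝ) (A x)) p μ := by
  let T : (n → n → ℝ) →ₗ[ℝ] (EuclideanSpace ℝ n →L[ℝ] EuclideanSpace ℝ n) :=
    { toFun := fun a => Matrix.toEuclideanCLM (n := n) (𝕜 := ℝ) (Matrix.of a)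
      map_add' := fun _ _ => map_add (Matrix.toEuclideanCLM (n := n) (𝕜 := ℝ)) _ _
      map_smul' := fun _ _ => map_smul (Matrix.toEuclideanCLM (n := n) (𝕜 := ℝ)) _ _ }
  have hentries : MemLp (fun x i j => A x i j) p μ :=
    memLp_pi_iff.2 fun i => memLp_pi_iff.2 fun j => hA i j
  exact (LinearMap.toContinuousLinearMap T).comp_memLp' hentries

theorem IsEllipticField.exists_mul_norm_sq_le {A : α → Matrix n n ℝ} (hA : IsEllipticField μ A) :
    ∃ a > 0, ∀ u : Lp (EuclideanSpace ℝ n) 2 μ,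
      a * ‖u‖ ^ 2 ≤ inner ℝ (mulOp (memLp_toEuclideanCLM hA.memLp_top) u) u := by
  obtain ⟨a, ha, h⟩ := hA.posDef
  refine ⟨a, ha, mul_norm_sq_le_inner_mulOp _ ?_⟩
  filter_upwards [h] with x hx ξ
  rw [inner_toEuclideanCLM, dotProduct_comm]
  exact hx ξ

end elliptic

/-! ### The penalized state equation -/

section H0curl

variable {Ω : Set E3}

theorem isClosed_Hcurl : IsClosed (Hcurl Ω : Set (L2Pair Ω)) := by
  have h : (Hcurl Ω : Set (L2Pair Ω)) = ⋂ (φ : E3 → E3) (hφ : IsTestField Ω φ),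
      {p | inner ℝ p.snd (hφ.memLp.toLp φ) = inner ℝ p.fst (hφ.memLp_curl.toLp (curl φ))} := by
    ext p
    simp only [mem_iInter, mem_ofPred_eq, ← integral_inner_eq_inner_toLp]
    rfl
  rw [h]
  refine isClosed_iInter fun φ => isClosed_iInter fun hφ => ?_
  exact isClosed_eq
    ((WithLp.sndL 2 ℝ (L2Field Ω) (L2Field Ω)).continuous.inner continuous_const)
    ((WithLp.fstL 2 ℝ (L2Field Ω) (L2Field Ω)).continuous.inner continuous_const)

instance : CompleteSpace (H0curl Ω) :=
  (isClosed_Hcurl.inter (Submodule.isClosed_topologicalClosure _)).completeSpace_coe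

/-- The embedding of `H₀(curl)` into the square integrable fields. -/
def fieldL (Ω : Set E3) : H0curl Ω →L[ℝ] L2Field Ω :=
  (WithLp.fstL 2 ℝ (L2Field Ω) (L2Field Ω)).comp (H0curl Ω).subtypeL

/-- The curl as a continuous linear map on `H₀(curl)`. -/
def rotL (Ω : Set E3) : H0curl Ω →L[ℝ] L2Field Ω :=
  (WithLp.sndL 2 ℝ (L2Field Ω) (L2Field Ω)).comp (H0curl Ω).subtypeL

theorem norm_sq_H0curl (v : H0curl Ω) : ‖v‖ ^ 2 = ‖fieldL Ω v‖ ^ 2 + ‖rotL Ω v‖ ^ 2 :=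
  WithLp.prod_norm_sq_eq_of_L2 v.1

end H0curl

namespace HTSData

/-- The measurability, integrability and ellipticity assumptions on the data, without regularity of
the sets or of the coefficients. -/
structure WeaklyAdmissible (D : HTSData) : Prop where
  measurableSet_B : MeasurableSet D.B
  volume_B_ne_top : volume D.B ≠ ∞
  subset : D.B ⊆ D.Ω
  memLp_Ed : MemLp D.Ed 2 (volume.restrict D.B)
  memLp_κ : MemLp D.κ ∞ (volume.restrict D.B)
  jc_nonneg : 0 ≤ D.jc
  elliptic_ν : IsEllipticField (volume.restrict D.Ω) D.ν
  elliptic_ε : IsEllipticField (volume.restrict D.Ω) D.ε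
  memLp_f : MemLp D.f 2 (volume.restrict D.Ω)

variable {D : HTSData} {γ : ℝ} {ω : Set E3}

namespace WeaklyAdmissible

/-- The bounded operator on `H₀(curl)` that represents the bilinear form `a`. -/
def bilinOp (hD : D.WeaklyAdmissible) : H0curl D.Ω →L[ℝ] H0curl D.Ω :=
  (fieldL D.Ω).adjoint ∘L mulOp (memLp_toEuclideanCLM hD.elliptic_ε.memLp_top) ∘L fieldL D.Ω +
    (rotL D.Ω).adjoint ∘L mulOp (memLp_toEuclideanCLM hD.elliptic_ν.memLp_top) ∘L rotL D.Ω

theorem inner_bilinOp (hD : D.WeaklyAdmissible) (v w : H0curl D.Ω) :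
    inner ℝ (hD.bilinOp v) w
      = inner ℝ (mulOp (memLp_toEuclideanCLM hD.elliptic_ε.memLp_top) (fieldL D.Ω v))
          (fieldL D.Ω w)
        + inner ℝ (mulOp (memLp_toEuclideanCLM hD.elliptic_ν.memLp_top) (rotL D.Ω v))
          (rotL D.Ω w) := by
  simp only [bilinOp, add_apply, ContinuousLinearMap.comp_apply, inner_add_left,
    ContinuousLinearMap.adjoint_inner_left]

theorem inner_bilinOp_eq_bilin (hD : D.WeaklyAdmissible) (v w : H0curl D.Ω) :
    inner ℝ (hD.bilinOp v) w = D.bilin v w := by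
  rw [inner_bilinOp, inner_mulOp, inner_mulOp, add_comm]
  simp only [inner_toEuclideanCLM]
  rfl

theorem exists_mul_norm_sq_le_inner_bilinOp (hD : D.WeaklyAdmissible) :
    ∃ c > 0, ∀ v, c * ‖v‖ ^ 2 ≤ inner ℝ (hD.bilinOp v) v := by
  obtain ⟨a, ha, h⟩ := hD.elliptic_ε.exists_mul_norm_sq_le
  obtain ⟨b, hb, h'⟩ := hD.elliptic_ν.exists_mul_norm_sq_le
  refine ⟨min a b, lt_min ha hb, fun v => ?_⟩
  rw [inner_bilinOp, norm_sq_H0curl, mul_add]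
  exact add_le_add ((mul_le_mul_of_nonneg_right (min_le_left a b) (sq_nonneg _)).trans (h _))
    ((mul_le_mul_of_nonneg_right (min_le_right a b) (sq_nonneg _)).trans (h' _))

/-- The right-hand side of the state equation as an element of `H₀(curl)`. -/
def load (hD : D.WeaklyAdmissible) : H0curl D.Ω :=
  (fieldL D.Ω).adjoint (hD.memLp_f.toLp D.f)

theorem inner_load (hD : D.WeaklyAdmissible) (v : H0curl D.Ω) :
    inner ℝ hD.load v = ∫ x in D.Ω, inner ℝ (D.f x) (field v x) := by
  rw [load, ContinuousLinearMap.adjoint_inner_left, real_inner_comm,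
    ← integral_inner_eq_inner_toLp]
  exact integral_congr_ae (Eventually.of_forall fun x => real_inner_comm _ _)

/-- The superposition operator of `dualMap` on square integrable fields. -/
def dualOp (hD : D.WeaklyAdmissible) (hγ : 0 < γ) : L2Field D.Ω → L2Field D.Ω :=
  (lipschitzWith_dualMap hD.jc_nonneg hγ).compLp dualMap_zero

/-- The operator on `H₀(curl)` of the penalized state equation for the shape `ω`. -/
def stateOp (hD : D.WeaklyAdmissible) (hγ : 0 < γ) (hω : MeasurableSet ω) (E : H0curl D.Ω) :
    H0curl D.Ω :=
  hD.bilinOp E + (fieldL D.Ω).adjoint (cutoff hω (hD.dualOp hγ (fieldL D.Ω E)))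

section stateOp

variable (hD : D.WeaklyAdmissible) (hγ : 0 < γ) (hω : MeasurableSet ω)

theorem inner_stateOp (hωΩ : ω ⊆ D.Ω) (E v : H0curl D.Ω) :
    inner ℝ (hD.stateOp hγ hω E) v
      = D.bilin E v + ∫ x in ω, inner ℝ (dualMap D.jc γ (field E x)) (field v x) := by
  rw [stateOp, inner_add_left, inner_bilinOp_eq_bilin, ContinuousLinearMap.adjoint_inner_left,
    inner_cutoff, Measure.restrict_restrict hω, inter_eq_self_of_subset_left hωΩ]
  congr 1
  refine integral_congr_ae (ae_restrict_of_ae_restrict_of_subset hωΩ ?_)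
  filter_upwards [LipschitzWith.coeFn_compLp (lipschitzWith_dualMap hD.jc_nonneg hγ) dualMap_zero
    (fieldL D.Ω E)] with x hx
  rw [dualOp, hx]
  rfl

theorem isState_iff (hωΩ : ω ⊆ D.Ω) (E : H0curl D.Ω) :
    D.IsState γ ω E ↔ hD.stateOp hγ hω E = hD.load := by
  simp only [IsState, ← hD.inner_stateOp hγ hω hωΩ, ← hD.inner_load]
  exact ⟨fun h => ext_inner_right ℝ h, fun h v => by rw [h]⟩

theorem exists_lipschitzWith_stateOp : ∃ K, LipschitzWith K (hD.stateOp hγ hω) :=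
  ⟨_, hD.bilinOp.lipschitz.add
    ((((fieldL D.Ω).adjoint ∘L cutoff hω).lipschitz.comp
      (LipschitzWith.lipschitzWith_compLp (lipschitzWith_dualMap hD.jc_nonneg hγ)
        dualMap_zero)).comp (fieldL D.Ω).lipschitz)⟩

theorem exists_isStronglyMonotone_stateOp : ∃ c > 0, ∀ {ω : Set E3} (hω : MeasurableSet ω),
    IsStronglyMonotone c (hD.stateOp hγ hω) := by
  obtain ⟨c, hc, h⟩ := hD.exists_mul_norm_sq_le_inner_bilinOp
  refine ⟨c, hc, fun hω u v => ?_⟩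
  rw [stateOp, stateOp, add_sub_add_comm, inner_add_left, ← map_sub, ← map_sub, ← map_sub,
    ContinuousLinearMap.adjoint_inner_left, map_sub (fieldL D.Ω)]
  exact le_add_of_le_of_nonneg (h _) (inner_cutoff_compLp_sub_nonneg _ _
    (inner_dualMap_sub_nonneg hD.jc_nonneg hγ) _ _ _)

include hD hγ hω

theorem existsUnique_isState (hωΩ : ω ⊆ D.Ω) : ∃! E : H0curl D.Ω, D.IsState γ ω E := by
  obtain ⟨K, hK⟩ := hD.exists_lipschitzWith_stateOp hγ hω
  obtain ⟨c, hc, hmono⟩ := hD.exists_isStronglyMonotone_stateOp hγ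
  simp only [hD.isState_iff hγ hω hωΩ]
  exact (hmono hω).existsUnique_eq hc hK _

theorem isState_state (hωΩ : ω ⊆ D.Ω) : D.IsState γ ω (D.state γ ω) :=
  Classical.epsilon_spec (hD.existsUnique_isState hγ hω hωΩ).exists

end stateOp

theorem continuousOn_state (hD : D.WeaklyAdmissible) (hγ : 0 < γ) :
    ContinuousOn (fun ω : MeasuredSets (volume : Measure E3) => D.state γ (ω : Set E3))
      {ω | (ω : Set E3) ⊆ D.Ω} := by
  rw [continuousOn_iff_continuous_domRestrict, continuous_iff_continuousAt]
  intro ω₀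
  obtain ⟨c, hc, hmono⟩ := hD.exists_isStronglyMonotone_stateOp hγ
  have hstate (ω : {ω : MeasuredSets (volume : Measure E3) | (ω : Set E3) ⊆ D.Ω}) :
      hD.stateOp hγ ω.1.2 (D.state γ (ω : Set E3)) = hD.load :=
    (hD.isState_iff hγ ω.1.2 ω.2 _).1 (hD.isState_state hγ ω.1.2 ω.2)
  refine IsStronglyMonotone.tendsto_solution (fun ω => hmono ω.1.2) hc hstate ?_
  rw [← hstate ω₀]
  refine tendsto_const_nhds.add (((fieldL D.Ω).adjoint.continuous.tendsto _).comp ?_)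
  refine tendsto_cutoff ENNReal.ofNat_ne_top _ _ ?_ _
  exact tendsto_of_tendsto_of_tendsto_of_le_of_le tendsto_const_nhds
    (tendsto_iff_edist_tendsto_0.1 (continuous_subtype_val.tendsto ω₀)) (fun _ => zero_le)
    fun _ => Measure.restrict_le_self _

/-! ### The cost functional -/

theorem continuous_tracking (hD : D.WeaklyAdmissible) :
    Continuous fun E : H0curl D.Ω => ∫ x in D.B, D.κ x * ‖field E x - D.Ed x‖ ^ 2 := by
  have hB : (volume.restrict D.Ω).restrict D.B = volume.restrict D.B := by
    rw [Measure.restrict_restrict hD.measurableSet_B, inter_eq_self_of_subset_left hD.subset]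
  have hκ : MemLp (D.B.indicator D.κ) ∞ (volume.restrict D.Ω) := by
    rw [memLp_indicator_iff_restrict hD.measurableSet_B, hB]
    exact hD.memLp_κ
  have hEd : MemLp (D.B.indicator D.Ed) 2 (volume.restrict D.Ω) := by
    rw [memLp_indicator_iff_restrict hD.measurableSet_B, hB]
    exact hD.memLp_Ed
  refine ((continuous_integral_mul_norm_sub_sq hκ hEd).comp (fieldL D.Ω).continuous).congr
    fun E => ?_
  rw [Function.comp_apply, ← hB, ← integral_indicator hD.measurableSet_B]
  refine integral_congr_ae (Eventually.of_forall fun x => ?_)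
  by_cases hx : x ∈ D.B
  · simp only [hx, indicator_of_mem]
    rfl
  · simp only [hx, not_false_eq_true, indicator_of_notMem, zero_mul]

theorem continuousOn_cost (hD : D.WeaklyAdmissible) (hγ : 0 < γ) :
    ContinuousOn (fun ω : MeasuredSets (volume : Measure E3) => D.cost γ (ω : Set E3))
      {ω | (ω : Set E3) ⊆ D.B} := by
  refine ((hD.continuous_tracking.comp_continuousOn ((hD.continuousOn_state hγ).mono
    fun ω hω => hω.trans hD.subset)).const_mul _).add ?_
  simp only [integral_const, smul_eq_mul, mul_one, measureReal_restrict_apply_univ]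
  exact ENNReal.continuousOn_toReal.comp MeasuredSets.continuous_measure.continuousOn
    fun ω hω => ne_top_of_le_ne_top hD.volume_B_ne_top (measure_mono hω)

theorem exists_isMinOn_cost (hD : D.WeaklyAdmissible) (L : ℝ≥0) {r : ℝ} (hr : 0 < r)
    (hγ : 0 < γ) : ∃ ω ∈ D.shapes L r, IsMinOn (D.cost γ) (D.shapes L r) ω := by
  have hcompact := isCompact_uniformlyLipschitz (L := L) hD.measurableSet_B hD.volume_B_ne_top hr
  have hempty : IsUniformlyLipschitz L r ∅ := fun x hx => by simp at hx
  obtain ⟨ω, hω, hmin⟩ := hcompact.exists_isMinOn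
    ⟨⟨∅, MeasurableSet.empty⟩, empty_subset _, isOpen_empty, hempty⟩
    ((hD.continuousOn_cost hγ).mono fun ω hω => hω.1)
  exact ⟨ω, hω, fun ω' hω' => hmin (a := ⟨ω', hω'.2.1.measurableSet⟩) hω'⟩

end WeaklyAdmissible

end HTSData

theorem theorem3p2_general (D : HTSData) (hD : D.WeaklyAdmissible) (L : ℝ≥0) (r : ℝ) (hr : 0 < r)
    (γ : ℝ) (hγ : 0 < γ) :
    (∀ ω ∈ D.shapes L r, ∃! E : H0curl D.Ω, D.IsState γ ω E) ∧
      ∃ ωopt ∈ D.shapes L r, ∀ ω ∈ D.shapes L r, D.cost γ ωopt ≤ D.cost γ ω := by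
  refine ⟨fun ω hω => hD.existsUnique_isState hγ hω.2.1.measurableSet (hω.1.trans hD.subset), ?_⟩
  obtain ⟨ω, hω, hmin⟩ := hD.exists_isMinOn_cost L hr hγ
  exact ⟨ω, hω, isMinOn_iff.1 hmin⟩

theorem IsC1.memLp {F : Type*} [NormedAddCommGroup F] [NormedSpace ℝ F] {B : Set E3} {u : E3 → F}
    (hu : IsC1 B u) (hB : IsOpen B) (hvol : volume B ≠ ∞) (p : ℝ≥0∞) :
    MemLp u p (volume.restrict B) := by
  obtain ⟨C, hC⟩ := hu.2
  have : IsFiniteMeasure (volume.restrict B) := isFiniteMeasure_restrict.2 hvol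
  refine MemLp.of_bound (hu.1.continuousOn.aestronglyMeasurable hB.measurableSet) C ?_
  filter_upwards [ae_restrict_mem hB.measurableSet] with x hx
  exact (hC x hx).1

theorem IsMaterialParameter.isEllipticField {Ω B : Set E3} {A : E3 → Matrix (Fin 3) (Fin 3) ℝ}
    (hA : IsMaterialParameter Ω B A) : IsEllipticField (volume.restrict Ω) A :=
  ⟨hA.memLp_top, hA.posDef⟩

theorem HTSData.Admissible.weaklyAdmissible {D : HTSData} (hD : D.Admissible) :
    D.WeaklyAdmissible where
  measurableSet_B := hD.lipschitz_B.1.measurableSet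
  volume_B_ne_top := (hD.bounded.subset hD.subset).measure_lt_top.ne
  subset := hD.subset
  memLp_Ed := hD.isC1_Ed.memLp hD.lipschitz_B.1 (hD.bounded.subset hD.subset).measure_lt_top.ne 2
  memLp_κ := hD.isC1_κ.memLp hD.lipschitz_B.1 (hD.bounded.subset hD.subset).measure_lt_top.ne ∞
  jc_nonneg := hD.jc_pos.le
  elliptic_ν := hD.material_ν.isEllipticField
  elliptic_ε := hD.material_ε.isEllipticField
  memLp_f := hD.memLp_f

end

theorem theorem3p2 (D : HTSData) (hD : D.Admissible) (L : ℝ≥0) (r : ℝ) (hr : 0 < r)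
    (γ : ℝ) (hγ : 0 < γ) :
    (∀ ω ∈ D.shapes L r, ∃! E : H0curl D.Ω, D.IsState γ ω E) ∧
      ∃ ωopt ∈ D.shapes L r, ∀ ω ∈ D.shapes L r, D.cost γ ωopt ≤ D.cost γ ω :=
  theorem3p2_general D hD.weaklyAdmissible L r hr γ hγ
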